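/- Let $T$ be a (nondegenerate, geodesic) tetrahedron in hyperbolic $3$-space $\mathbb{H}^3$, each of whose four vertices is either a point of $\mathbb{H}^3$ or an ideal point of $\partial\mathbb{H}^3$. If $T$ has dihedral angle $\alpha$ along one of its edges $e$, then $T$ has finite hyperbolic volume and $$\operatorname{Vol}(T)\le 2\Lambda\!\left(\frac{\alpha}{2}\right),$$ where $\Lambda(\theta)=-\int_0^\theta\log|2\sin u|\,\mathrm{d}u$ is the Lobachevsky function. -/

import Mathlib

open MeasureTheory

/-- The ambient Euclidean space of the projective (Beltrami--Klein) model.  Hyperbolic `3`-space is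
its open unit ball, the sphere at infinity is the unit sphere, and the geodesics and totally
geodesic planes are the intersections of the ball with affine lines and planes. -/
abbrev E3 : Type := EuclideanSpace ℝ (Fin 3)

/-- Hyperbolic `3`-space in the projective model. -/
def hyp3 : Set E3 := Metric.ball 0 1

/-- The Riemannian metric (of constant curvature `-1`) of the projective model at `x`,
evaluated at the tangent vectors `u` and `w`. -/
noncomputable def hypMetric (x u w : E3) : ℝ :=
  inner ℝ u w / (1 - ‖x‖ ^ 2) + inner ℝ x u * inner ℝ x w / (1 - ‖x‖ ^ 2) ^ 2

/-- The Riemannian volume density `√(det g)` of the projective model. -/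
noncomputable def hypDensity (x : E3) : ℝ := ((1 - ‖x‖ ^ 2) ^ 2)⁻¹

/-- `hypDensity` is indeed the volume density of the metric `hypMetric`. -/
theorem hypDensity_eq_sqrt_det (x : E3) (hx : x ∈ hyp3) :
    hypDensity x = √(Matrix.det (Matrix.of fun i j : Fin 3 =>
      hypMetric x (EuclideanSpace.single i 1) (EuclideanSpace.single j 1))) := by
  have hx1 : ‖x‖ < 1 := by simpa [hyp3] using hx
  have hn : ‖x‖ ^ 2 = x 0 ^ 2 + x 1 ^ 2 + x 2 ^ 2 := by
    simp [EuclideanSpace.norm_sq_eq, Fin.sum_univ_three]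
  have hpos : 0 < 1 - ‖x‖ ^ 2 := by nlinarith [norm_nonneg x]
  have key : Matrix.det (Matrix.of fun i j : Fin 3 =>
      hypMetric x (EuclideanSpace.single i 1) (EuclideanSpace.single j 1))
      = hypDensity x ^ 2 := by
    rw [Matrix.det_fin_three]
    simp only [Matrix.of_apply, hypMetric, hypDensity, EuclideanSpace.inner_single_right]
    simp
    have h0 : x 0 ^ 2 = 1 - (1 - ‖x‖ ^ 2) - x 1 ^ 2 - x 2 ^ 2 := by rw [hn]; ring
    generalize 1 - ‖x‖ ^ 2 = r at *
    field_simp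
    linear_combination r ^ 2 * h0
  rw [key, Real.sqrt_sq (by unfold hypDensity; positivity)]

/-- Hyperbolic volume, as a measure. -/
noncomputable def hypVolume : Measure E3 :=
  (volume.restrict hyp3).withDensity fun x => ENNReal.ofReal (hypDensity x)

/-- The Riemannian angle at `x` between the tangent vectors `u` and `w`. -/
noncomputable def hypAngle (x u w : E3) : ℝ :=
  Real.arccos (hypMetric x u w / (√(hypMetric x u u) * √(hypMetric x w w)))

/-- The component of the tangent vector `w` at `x` that is orthogonal to `u`
with respect to the hyperbolic metric at `x`. -/
noncomputable def hypOrthComponent (x u w : E3) : E3 :=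
  w - (hypMetric x u w / hypMetric x u u) • u

/-- A nondegenerate geodesic hyperbolic tetrahedron, given by its vertices.  Each vertex is a point
of hyperbolic space or an ideal point (a point of the sphere at infinity). -/
structure HypTetrahedron where
  vertex : Fin 4 → E3
  norm_le_one : ∀ i, ‖vertex i‖ ≤ 1
  independent : AffineIndependent ℝ vertex

namespace HypTetrahedron

/-- The set of points of hyperbolic space that belong to the tetrahedron: the geodesic convex hull
of the vertices, without the ideal vertices. -/
def carrier (T : HypTetrahedron) : Set E3 :=
  convexHull ℝ (Set.range T.vertex) ∩ hyp3

/-- The dihedral angle of the tetrahedron along the edge joining the vertices `i` and `j`, measured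
at a point `p` of that edge; `k` and `l` are the two other vertices.  It is the angle at `p` between
the two tangent vectors that are orthogonal to the edge and point into the faces `i, j, k` and
`i, j, l`. -/
noncomputable def dihedralAngle (T : HypTetrahedron) (i j k l : Fin 4) (p : E3) : ℝ :=
  hypAngle p
    (hypOrthComponent p (T.vertex j - T.vertex i) (T.vertex k - p))
    (hypOrthComponent p (T.vertex j - T.vertex i) (T.vertex l - p))

end HypTetrahedron

/-- The Lobachevsky function `Λ(θ) = -∫₀^θ log |2 sin u| du`. -/
noncomputable def lobachevsky (θ : ℝ) : ℝ :=
  -∫ u in (0 : ℝ)..θ, Real.log |2 * Real.sin u|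

/-- The logarithmic profile dominating the angular slices of a wedge of opening angle `α`. -/
noncomputable def wedgeProfile (α θ : ℝ) : ℝ :=
  Real.log (Real.cos (θ - α / 2)) - Real.log (Real.sin θ) / 2 - Real.log (Real.sin (α - θ)) / 2

theorem intervalIntegrable_log_sin_comp (a b : ℝ) :
    IntervalIntegrable (fun x => Real.log (Real.sin x)) volume a b :=
  intervalIntegrable_log_sin

theorem intervalIntegrable_log_cos_comp (a b : ℝ) :
    IntervalIntegrable (fun x => Real.log (Real.cos x)) volume a b :=
  intervalIntegrable_log_cos

theorem intervalIntegrable_wedgeProfile (α : ℝ) :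
    IntervalIntegrable (wedgeProfile α) volume 0 α := by
  have h1 := (intervalIntegrable_log_cos_comp (0 - α / 2) (α - α / 2)).comp_sub_right (α / 2)
  have h2 := (intervalIntegrable_log_sin_comp α 0).comp_sub_left α
  simp only [sub_add_cancel, sub_self, sub_zero] at h1 h2
  exact (h1.sub ((intervalIntegrable_log_sin_comp 0 α).div_const 2)).sub (h2.div_const 2)

theorem two_mul_lobachevsky_half {α : ℝ} (h0 : 0 < α) (hpi : α < Real.pi) :
    2 * lobachevsky (α / 2) =
      -α * Real.log 2 - 2 * ∫ x in (0 : ℝ)..α / 2, Real.log (Real.sin x) := by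
  have h : ∫ u in (0 : ℝ)..α / 2, Real.log |2 * Real.sin u| =
      ∫ u in (0 : ℝ)..α / 2, (Real.log 2 + Real.log (Real.sin u)) := by
    refine intervalIntegral.integral_congr_ae (Filter.Eventually.of_forall fun x hx => ?_)
    rw [Set.uIoc_of_le (by linarith)] at hx
    have : 0 < Real.sin x := Real.sin_pos_of_pos_of_lt_pi hx.1 (by linarith [hx.2])
    rw [Real.log_abs, Real.log_mul two_ne_zero this.ne']
  rw [lobachevsky, h, intervalIntegral.integral_add (by simp) (intervalIntegrable_log_sin_comp _ _)]
  simp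
  ring

theorem integral_log_sin_zero_eq {α : ℝ} (h0 : 0 < α) (hpi : α < Real.pi) :
    ∫ x in (0 : ℝ)..α, Real.log (Real.sin x) =
      α * Real.log 2 + 2 * (∫ x in (0 : ℝ)..α / 2, Real.log (Real.sin x)) +
        2 * ∫ x in (0 : ℝ)..α / 2, Real.log (Real.cos x) := by
  have h1 := intervalIntegral.integral_comp_mul_left (a := 0) (b := α / 2)
    (fun x => Real.log (Real.sin x)) (two_ne_zero' ℝ)
  have h : ∫ x in (0 : ℝ)..α / 2, Real.log (Real.sin (2 * x)) =
      ∫ x in (0 : ℝ)..α / 2,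
        (Real.log 2 + Real.log (Real.sin x) + Real.log (Real.cos x)) := by
    refine intervalIntegral.integral_congr_ae (Filter.Eventually.of_forall fun x hx => ?_)
    rw [Set.uIoc_of_le (by linarith)] at hx
    have hs : 0 < Real.sin x := Real.sin_pos_of_pos_of_lt_pi hx.1 (by linarith [hx.2])
    have hc : 0 < Real.cos x :=
      Real.cos_pos_of_mem_Ioo ⟨by linarith [hx.1, Real.pi_pos], by linarith [hx.2]⟩
    rw [Real.sin_two_mul, Real.log_mul (by positivity) hc.ne', Real.log_mul two_ne_zero hs.ne']
  rw [h, intervalIntegral.integral_add, intervalIntegral.integral_add] at h1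
  · simp only [mul_zero, mul_div_cancel₀ α (two_ne_zero' ℝ), intervalIntegral.integral_const,
      smul_eq_mul] at h1
    linarith
  · simp
  · exact intervalIntegrable_log_sin_comp _ _
  · exact (by simp : IntervalIntegrable (fun _ => Real.log 2) volume 0 (α / 2)).add
      (intervalIntegrable_log_sin_comp _ _)
  · exact intervalIntegrable_log_cos_comp _ _

theorem integral_log_cos_symm (β : ℝ) :
    ∫ x in (-β)..β, Real.log (Real.cos x) = 2 * ∫ x in (0 : ℝ)..β, Real.log (Real.cos x) := by
  rw [← intervalIntegral.integral_add_adjacent_intervals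
    (intervalIntegrable_log_cos_comp (-β) 0) (intervalIntegrable_log_cos_comp 0 β)]
  have := intervalIntegral.integral_comp_neg (a := 0) (b := β) fun x => Real.log (Real.cos x)
  simp only [Real.cos_neg, neg_zero] at this
  linarith

theorem integral_wedgeProfile {α : ℝ} (h0 : 0 < α) (hpi : α < Real.pi) :
    ∫ θ in (0 : ℝ)..α, wedgeProfile α θ = 2 * lobachevsky (α / 2) := by
  have h1 := (intervalIntegrable_log_cos_comp (0 - α / 2) (α - α / 2)).comp_sub_right (α / 2)
  have h2 := (intervalIntegrable_log_sin_comp α 0).comp_sub_left α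
  simp only [sub_add_cancel, sub_self, sub_zero] at h1 h2
  have h3 := intervalIntegrable_log_sin_comp 0 α
  have e1 := intervalIntegral.integral_comp_sub_right (a := 0) (b := α)
    (fun x => Real.log (Real.cos x)) (α / 2)
  have e2 := intervalIntegral.integral_comp_sub_left (a := 0) (b := α)
    (fun x => Real.log (Real.sin x)) α
  rw [zero_sub, show α - α / 2 = α / 2 by ring, integral_log_cos_symm] at e1
  rw [sub_self, sub_zero] at e2
  simp only [wedgeProfile]
  rw [intervalIntegral.integral_sub (h1.sub (h3.div_const 2)) (h2.div_const 2),
    intervalIntegral.integral_sub h1 (h3.div_const 2), intervalIntegral.integral_div,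
    intervalIntegral.integral_div, e1, e2, integral_log_sin_zero_eq h0 hpi,
    two_mul_lobachevsky_half h0 hpi]
  ring

theorem sin_sq_eq_law_of_cosines (α θ : ℝ) :
    Real.sin α ^ 2 = Real.sin θ ^ 2 + Real.sin (α - θ) ^ 2 +
      2 * Real.sin θ * Real.sin (α - θ) * Real.cos α := by
  rw [Real.sin_sub]
  linear_combination Real.sin θ ^ 2 * Real.sin_sq_add_cos_sq α -
    Real.sin α ^ 2 * Real.sin_sq_add_cos_sq θ

theorem sin_add_sin_sq_eq (α θ : ℝ) :
    (Real.sin θ + Real.sin (α - θ)) ^ 2 =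
      2 * (1 - Real.cos α) * Real.cos (θ - α / 2) ^ 2 := by
  have h1 : Real.sin θ + Real.sin (α - θ) = 2 * Real.sin (α / 2) * Real.cos (θ - α / 2) := by
    have e : ∀ x y, Real.sin (x + y) + Real.sin (x - y) = 2 * Real.sin x * Real.cos y :=
      fun x y => by rw [Real.sin_add, Real.sin_sub]; ring
    rw [← e]
    ring_nf
  have h2 : Real.cos α = 1 - 2 * Real.sin (α / 2) ^ 2 := by
    have := Real.cos_two_mul (α / 2)
    rw [mul_div_cancel₀ α (two_ne_zero' ℝ)] at this
    linarith [Real.sin_sq_add_cos_sq (α / 2)]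
  rw [h1, h2]
  ring

/-- The radial extent of a wedge slice is less than its pole; the logarithm of the corresponding
cross ratio is greatest for the symmetric wedge. -/
theorem wedge_slice_bounds {α θ A B : ℝ} (hA : 0 < A) (hB : 0 < B) (h0 : 0 < θ) (h1 : θ < α)
    (hpi : α < Real.pi) {l R : ℝ}
    (hl : l = (A * Real.sin (α - θ) + B * Real.sin θ) / Real.sin α)
    (hR : R = Real.sin α / (Real.sin (α - θ) / A + Real.sin θ / B)) :
    0 < R ∧ R < l ∧ Real.log (l / (l - R)) / 2 ≤ wedgeProfile α θ := by
  have hs : 0 < Real.sin θ := Real.sin_pos_of_pos_of_lt_pi h0 (by linarith)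
  have ht : 0 < Real.sin (α - θ) := Real.sin_pos_of_pos_of_lt_pi (by linarith) (by linarith)
  have hσ : 0 < Real.sin α := Real.sin_pos_of_pos_of_lt_pi (by linarith) hpi
  have hc : 0 < Real.cos (θ - α / 2) :=
    Real.cos_pos_of_mem_Ioo ⟨by linarith [Real.pi_pos], by linarith [Real.pi_pos]⟩
  have hsq := sin_sq_eq_law_of_cosines α θ
  have hadd := sin_add_sin_sq_eq α θ
  have hC : Real.cos α < 1 := by
    nlinarith [Real.sin_sq_add_cos_sq α]
  have hC' : -1 < Real.cos α := by
    nlinarith [Real.sin_sq_add_cos_sq α]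
  rw [wedgeProfile]
  generalize Real.sin θ = s at *
  generalize Real.sin (α - θ) = t at *
  generalize Real.sin α = σ at *
  generalize Real.cos α = C at *
  generalize Real.cos (θ - α / 2) = q at *
  have hD : 0 < B * t + A * s := by positivity
  have hN : 0 < A * t + B * s := by positivity
  have hR' : R = σ * A * B / (B * t + A * s) := by
    rw [hR]; field_simp
  have hg : 0 < A ^ 2 + B ^ 2 - 2 * A * B * C := by nlinarith [mul_pos hA hB, sq_nonneg (A - B)]
  have hdiff : l - R = s * t * (A ^ 2 + B ^ 2 - 2 * A * B * C) / (σ * (B * t + A * s)) := by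
    rw [hl, hR']
    field_simp
    linear_combination (-A * B) * hsq
  have hpos : 0 < l - R := by rw [hdiff]; positivity
  refine ⟨by rw [hR']; positivity, by linarith, ?_⟩
  have hlog : Real.log q - Real.log s / 2 - Real.log t / 2 = Real.log (q ^ 2 / (s * t)) / 2 := by
    rw [Real.log_div (by positivity) (by positivity), Real.log_mul hs.ne' ht.ne', Real.log_pow]
    push_cast; ring
  rw [hlog]
  have hlpos : 0 < l := by rw [hl]; positivity
  refine div_le_div_of_nonneg_right (Real.log_le_log (by positivity) ?_) two_pos.le
  have hratio : l / (l - R) =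
      (A * t + B * s) * (B * t + A * s) / (s * t * (A ^ 2 + B ^ 2 - 2 * A * B * C)) := by
    rw [hdiff, hl]
    field_simp
  have hq : q ^ 2 = (s + t) ^ 2 / (2 * (1 - C)) := by
    rw [hadd, mul_div_cancel_left₀]
    nlinarith
  rw [hratio, hq, div_div, div_le_div_iff₀ (by positivity)
    (mul_pos (by linarith) (by positivity))]
  have : 0 ≤ (s * t) * ((A - B) ^ 2 * (s ^ 2 + t ^ 2 + 2 * s * t * C)) := by
    rw [← hsq]; positivity
  nlinarith [this]

theorem setLIntegral_Ici_inv_sq {c r l : ℝ} (hr : 0 < r) (hl : r < l) (hc : c = r * l) :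
    ∫⁻ w in Set.Ici c, ENNReal.ofReal (r / (2 * (w - r ^ 2) ^ 2)) =
      ENNReal.ofReal (1 / (2 * (l - r))) := by
  subst hc
  have hgt : ∀ w ∈ Set.Ici (r * l), 0 < w - r ^ 2 := fun w hw => by
    have : r * l ≤ w := hw
    nlinarith
  have hder : ∀ w ∈ Set.Ici (r * l),
      HasDerivAt (fun w => -(r / 2) * (w - r ^ 2)⁻¹) (r / (2 * (w - r ^ 2) ^ 2)) w := fun w hw => by
    have h := (((hasDerivAt_id w).sub_const (r ^ 2)).inv (hgt w hw).ne').const_mul (-(r / 2))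
    have := (hgt w hw).ne'
    refine HasDerivAt.congr_deriv h ?_
    rw [id]
    field_simp
  have hnn : ∀ w ∈ Set.Ioi (r * l), 0 ≤ r / (2 * (w - r ^ 2) ^ 2) := fun w _ => by positivity
  have hlim : Filter.Tendsto (fun w => -(r / 2) * (w - r ^ 2)⁻¹) Filter.atTop (nhds 0) := by
    have : Filter.Tendsto (fun w : ℝ => w - r ^ 2) Filter.atTop Filter.atTop :=
      Filter.tendsto_atTop_add_const_right _ _ Filter.tendsto_id
    simpa using (tendsto_inv_atTop_zero.comp this).const_mul (-(r / 2))
  rw [setLIntegral_congr Ioi_ae_eq_Ici.symm, ← ofReal_integral_eq_lintegral_ofReal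
    (integrableOn_Ioi_deriv_of_nonneg' hder hnn hlim)
    ((ae_restrict_iff' measurableSet_Ioi).2 (Filter.Eventually.of_forall hnn)),
    integral_Ioi_of_hasDerivAt_of_nonneg' hder hnn hlim]
  have : l - r ≠ 0 := (sub_pos.2 hl).ne'
  congr 1
  rw [show r * l - r ^ 2 = r * (l - r) by ring]
  field_simp
  ring

theorem setLIntegral_Ioc_inv {R l : ℝ} (hR : 0 < R) (hl : R < l) :
    ∫⁻ r in Set.Ioc 0 R, ENNReal.ofReal (1 / (2 * (l - r))) =
      ENNReal.ofReal (Real.log (l / (l - R)) / 2) := by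
  have hpos : ∀ r ∈ Set.Icc 0 R, 0 < l - r := fun r hr => by linarith [hr.2]
  have hder : ∀ r ∈ Set.uIcc 0 R,
      HasDerivAt (fun r => -(Real.log (l - r) / 2)) (1 / (2 * (l - r))) r := fun r hr => by
    rw [Set.uIcc_of_le hR.le] at hr
    have h := ((((hasDerivAt_id r).const_sub l).log (hpos r hr).ne').div_const 2).neg
    have := (hpos r hr).ne'
    refine HasDerivAt.congr_deriv h ?_
    rw [id]
    field_simp
  have hcont : ContinuousOn (fun r => 1 / (2 * (l - r))) (Set.uIcc 0 R) := by
    refine continuousOn_const.div (by fun_prop) fun r hr => ?_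
    rw [Set.uIcc_of_le hR.le] at hr
    have := hpos r hr
    positivity
  have hint := hcont.intervalIntegrable (μ := volume)
  have h := intervalIntegral.integral_eq_sub_of_hasDerivAt hder hint
  rw [intervalIntegral.integral_of_le hR.le] at h
  rw [← ofReal_integral_eq_lintegral_ofReal
    ((intervalIntegrable_iff_integrableOn_Ioc_of_le hR.le).1 hint)
    ((ae_restrict_iff' measurableSet_Ioc).2 (Filter.Eventually.of_forall fun r hr => by
      have := hpos r ⟨hr.1.le, hr.2⟩
      positivity)), h, Real.log_div (by linarith) (by linarith)]
  congr 1
  simp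
  ring

theorem lintegral_pi_fin_three {g : (Fin 3 → ℝ) → ENNReal} (hg : Measurable g) :
    ∫⁻ y, g y = ∫⁻ θ : ℝ, ∫⁻ r : ℝ, ∫⁻ w : ℝ, g ![w, r, θ] := by
  have h1 := (volume_preserving_piFinSuccAbove (fun _ : Fin 3 => ℝ) 2).symm
  have h2 := (volume_preserving_finTwoArrow ℝ).symm
  rw [← h1.lintegral_comp_emb (MeasurableEquiv.measurableEmbedding _)]
  have hg1 := hg.comp h1.measurable
  rw [Measure.volume_eq_prod, lintegral_prod (fun z => g ((MeasurableEquiv.piFinSuccAbove (fun _ => ℝ) 2).symm z))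
      hg1.aemeasurable]
  refine lintegral_congr fun θ => ?_
  rw [← h2.lintegral_comp_emb (MeasurableEquiv.measurableEmbedding _), Measure.volume_eq_prod,
    lintegral_prod_symm']
  · refine lintegral_congr fun r => lintegral_congr fun w => congrArg g ?_
    ext i
    fin_cases i <;> rfl
  · exact hg1.comp ((measurable_const).prodMk h2.measurable)

theorem wedgeProfile_nonneg {α θ : ℝ} (h0 : 0 < θ) (h1 : θ < α) (hpi : α < Real.pi) :
    0 ≤ wedgeProfile α θ := by
  obtain ⟨hR, hl, hle⟩ := wedge_slice_bounds one_pos one_pos h0 h1 hpi rfl rfl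
  refine le_trans (div_nonneg (Real.log_nonneg ?_) two_pos.le) hle
  rw [one_le_div (sub_pos.2 hl)]
  linarith

theorem two_mul_lobachevsky_half_nonneg {α : ℝ} (h0 : 0 < α) (hpi : α < Real.pi) :
    0 ≤ 2 * lobachevsky (α / 2) := by
  rw [← integral_wedgeProfile h0 hpi, intervalIntegral.integral_of_le h0.le,
    integral_Ioc_eq_integral_Ioo]
  exact setIntegral_nonneg measurableSet_Ioo fun θ hθ => wedgeProfile_nonneg hθ.1 hθ.2 hpi

/-- The coordinates `(w, r, θ)` of the points of a wedge of opening angle `α` that lie in the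
tetrahedron with two further ideal vertices, at distances `A` and `B`, on the sides of the wedge. -/
def wedgeRegion (α A B : ℝ) : Set (Fin 3 → ℝ) :=
  {y | 0 < y 2 ∧ y 2 < α ∧ 0 < y 1 ∧
    y 1 * (Real.sin (α - y 2) / A + Real.sin (y 2) / B) ≤ Real.sin α ∧
    y 1 * ((A * Real.sin (α - y 2) + B * Real.sin (y 2)) / Real.sin α) ≤ y 0}

theorem measurableSet_wedgeRegion (α A B : ℝ) : MeasurableSet (wedgeRegion α A B) := by
  unfold wedgeRegion
  measurability

theorem wedgeRegion_sq_lt {α A B : ℝ} (hA : 0 < A) (hB : 0 < B) (hpi : α < Real.pi)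
    {y : Fin 3 → ℝ} (hy : y ∈ wedgeRegion α A B) : y 1 ^ 2 < y 0 := by
  obtain ⟨h0, h1, hr, hR, hw⟩ := hy
  obtain ⟨-, hlt, -⟩ := wedge_slice_bounds hA hB h0 h1 hpi rfl rfl
  have hs : 0 < Real.sin (y 2) := Real.sin_pos_of_pos_of_lt_pi h0 (by linarith)
  have ht : 0 < Real.sin (α - y 2) := Real.sin_pos_of_pos_of_lt_pi (by linarith) (by linarith)
  rw [← le_div_iff₀ (by positivity)] at hR
  nlinarith

theorem setLIntegral_wedgeRegion_le {α A B : ℝ} (hA : 0 < A) (hB : 0 < B) (hα : 0 < α)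
    (hpi : α < Real.pi) :
    ∫⁻ y in wedgeRegion α A B, ENNReal.ofReal (y 1 / (2 * (y 0 - y 1 ^ 2) ^ 2)) ≤
      ENNReal.ofReal (2 * lobachevsky (α / 2)) := by
  have hm := measurableSet_wedgeRegion α A B
  rw [← lintegral_indicator hm, lintegral_pi_fin_three
    (Measurable.indicator (by fun_prop) hm)]
  calc
    _ ≤ ∫⁻ θ in Set.Ioo 0 α, ENNReal.ofReal (wedgeProfile α θ) := by
      rw [← lintegral_indicator measurableSet_Ioo]
      refine lintegral_mono fun θ => ?_
      by_cases hθ : θ ∈ Set.Ioo 0 α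
      swap
      · refine le_of_eq_of_le ?_ zero_le
        convert lintegral_zero with r
        convert lintegral_zero with w
        exact Set.indicator_of_notMem (fun h => hθ ⟨h.1, h.2.1⟩) _
      rw [Set.indicator_of_mem hθ]
      obtain ⟨hR, hl, hle⟩ := wedge_slice_bounds hA hB hθ.1 hθ.2 hpi rfl rfl
      have hs : 0 < Real.sin θ := Real.sin_pos_of_pos_of_lt_pi hθ.1 (by linarith [hθ.2])
      have ht : 0 < Real.sin (α - θ) :=
        Real.sin_pos_of_pos_of_lt_pi (by linarith [hθ.2]) (by linarith [hθ.1])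
      have hq : 0 < Real.sin (α - θ) / A + Real.sin θ / B := by positivity
      refine le_of_eq_of_le ?_ (ENNReal.ofReal_le_ofReal hle)
      rw [← setLIntegral_Ioc_inv hR hl, ← lintegral_indicator measurableSet_Ioc]
      refine lintegral_congr fun r => ?_
      by_cases hr : r ∈ Set.Ioc 0 (Real.sin α / (Real.sin (α - θ) / A + Real.sin θ / B))
      swap
      · rw [Set.indicator_of_notMem hr]
        convert lintegral_zero with w
        refine Set.indicator_of_notMem (fun h => hr ⟨h.2.2.1, ?_⟩) _
        rw [le_div_iff₀ hq]
        exact h.2.2.2.1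
      rw [Set.indicator_of_mem hr, ← setLIntegral_Ici_inv_sq hr.1 (hr.2.trans_lt hl) rfl,
        ← lintegral_indicator measurableSet_Ici]
      refine lintegral_congr fun w => ?_
      have hiff : ![w, r, θ] ∈ wedgeRegion α A B ↔
          w ∈ Set.Ici (r * ((A * Real.sin (α - θ) + B * Real.sin θ) / Real.sin α)) :=
        ⟨fun h => h.2.2.2.2, fun h => ⟨hθ.1, hθ.2, hr.1, (le_div_iff₀ hq).1 hr.2, h⟩⟩
      by_cases hw : ![w, r, θ] ∈ wedgeRegion α A B
      · rw [Set.indicator_of_mem hw, Set.indicator_of_mem (hiff.1 hw)]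
        rfl
      · rw [Set.indicator_of_notMem hw, Set.indicator_of_notMem (fun h => hw (hiff.2 h))]
    _ = ENNReal.ofReal (∫ θ in Set.Ioo 0 α, wedgeProfile α θ) := by
      refine (ofReal_integral_eq_lintegral_ofReal ?_ ?_).symm
      · exact (intervalIntegrable_iff_integrableOn_Ioo_of_le hα.le).1
          (intervalIntegrable_wedgeProfile α)
      · refine (ae_restrict_iff' measurableSet_Ioo).2 (Filter.Eventually.of_forall fun θ hθ => ?_)
        exact wedgeProfile_nonneg hθ.1 hθ.2 hpi
    _ = _ := by
      rw [← integral_Ioc_eq_integral_Ioo, ← intervalIntegral.integral_of_le hα.le,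
        integral_wedgeProfile hα hpi]

/-- The Minkowski bilinear form on `ℝ⁴`; the coordinate `0` is the time coordinate. -/
def mink (v w : Fin 4 → ℝ) : ℝ := v 1 * w 1 + v 2 * w 2 + v 3 * w 3 - v 0 * w 0

theorem mink_comm (v w : Fin 4 → ℝ) : mink v w = mink w v := by
  unfold mink; ring

theorem mink_add_left (u v w : Fin 4 → ℝ) : mink (u + v) w = mink u w + mink v w := by
  simp only [mink, Pi.add_apply]; ring

theorem mink_smul_left (t : ℝ) (v w : Fin 4 → ℝ) : mink (t • v) w = t * mink v w := by
  simp only [mink, Pi.smul_apply, smul_eq_mul]; ring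

theorem mink_add_right (u v w : Fin 4 → ℝ) : mink u (v + w) = mink u v + mink u w := by
  simp only [mink, Pi.add_apply]; ring

theorem mink_smul_right (t : ℝ) (v w : Fin 4 → ℝ) : mink v (t • w) = t * mink v w := by
  simp only [mink, Pi.smul_apply, smul_eq_mul]; ring

/-- Two null vectors `a`, `b` spanning the plane of a geodesic, and two unit vectors `c`, `d`
orthogonal to that plane and including the angle `α`. -/
structure IsWedgeFrame (a b c d : Fin 4 → ℝ) (α : ℝ) : Prop where
  aa : mink a a = 0
  bb : mink b b = 0
  ab : mink a b = -1 / 2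
  ac : mink a c = 0
  ad : mink a d = 0
  bc : mink b c = 0
  bd : mink b d = 0
  cc : mink c c = 1
  dd : mink d d = 1
  cd : mink c d = Real.cos α
  pos : 0 < α
  lt_pi : α < Real.pi

/-- The vector with coordinates `(w, r, θ)` with respect to a wedge frame. -/
noncomputable def wedgePoint (a b c d : Fin 4 → ℝ) (α : ℝ) (y : Fin 3 → ℝ) : Fin 4 → ℝ :=
  y 0 • a + b + (y 1 * Real.sin (α - y 2) / Real.sin α) • c +
    (y 1 * Real.sin (y 2) / Real.sin α) • d

/-- The partial derivatives of `wedgePoint`. -/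
noncomputable def wedgePointDeriv (a c d : Fin 4 → ℝ) (α : ℝ) (y : Fin 3 → ℝ) :
    Fin 3 → Fin 4 → ℝ :=
  ![a, (Real.sin (α - y 2) / Real.sin α) • c + (Real.sin (y 2) / Real.sin α) • d,
    (-(y 1 * Real.cos (α - y 2)) / Real.sin α) • c + (y 1 * Real.cos (y 2) / Real.sin α) • d]

/-- The point of the projective model with coordinates `(w, r, θ)` with respect to a wedge frame. -/
noncomputable def wedgeMap (a b c d : Fin 4 → ℝ) (α : ℝ) (y : Fin 3 → ℝ) : Fin 3 → ℝ :=
  fun i => wedgePoint a b c d α y i.succ / wedgePoint a b c d α y 0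

/-- The Jacobian matrix of `wedgeMap`. -/
noncomputable def wedgeJacobian (a b c d : Fin 4 → ℝ) (α : ℝ) (y : Fin 3 → ℝ) :
    Matrix (Fin 3) (Fin 3) ℝ :=
  Matrix.of fun i j =>
    (wedgePointDeriv a c d α y j i.succ * wedgePoint a b c d α y 0 -
      wedgePoint a b c d α y i.succ * wedgePointDeriv a c d α y j 0) /
        wedgePoint a b c d α y 0 ^ 2

theorem hasFDerivAt_wedgePoint (a b c d : Fin 4 → ℝ) (α : ℝ) (y : Fin 3 → ℝ) (k : Fin 4) :
    HasFDerivAt (fun y => wedgePoint a b c d α y k)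
      (∑ j, wedgePointDeriv a c d α y j k •
        (ContinuousLinearMap.proj j : (Fin 3 → ℝ) →L[ℝ] ℝ)) y := by
  have h0 := (ContinuousLinearMap.proj (R := ℝ) (φ := fun _ : Fin 3 => ℝ) 0).hasFDerivAt (x := y)
  have h1 := (ContinuousLinearMap.proj (R := ℝ) (φ := fun _ : Fin 3 => ℝ) 1).hasFDerivAt (x := y)
  have h2 := (ContinuousLinearMap.proj (R := ℝ) (φ := fun _ : Fin 3 => ℝ) 2).hasFDerivAt (x := y)
  have h := (((h0.mul_const (a k)).add_const (b k)).add
    ((h1.mul (h2.const_sub α).sin).mul_const (c k / Real.sin α))).add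
    ((h1.mul h2.sin).mul_const (d k / Real.sin α))
  refine (h.congr_fderiv ?_).congr_of_eventuallyEq (Filter.Eventually.of_forall fun z => ?_)
  · ext v
    simp [wedgePointDeriv, Fin.sum_univ_three]
    ring
  · simp [wedgePoint]
    ring

theorem hasFDerivAt_wedgeMap {a b c d : Fin 4 → ℝ} {α : ℝ} {y : Fin 3 → ℝ}
    (h : wedgePoint a b c d α y 0 ≠ 0) :
    HasFDerivAt (wedgeMap a b c d α)
      (LinearMap.toContinuousLinearMap (Matrix.toLin' (wedgeJacobian a b c d α y))) y := by
  rw [hasFDerivAt_pi']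
  intro i
  have hd := (hasFDerivAt_wedgePoint a b c d α y i.succ).mul
    ((hasDerivAt_inv h).comp_hasFDerivAt y (hasFDerivAt_wedgePoint a b c d α y 0))
  refine (hd.congr_fderiv ?_).congr_of_eventuallyEq
    (Filter.Eventually.of_forall fun z => div_eq_mul_inv _ _)
  ext v
  simp [wedgeJacobian, Matrix.mulVec, dotProduct, Fin.sum_univ_three]
  field_simp
  ring

theorem det_fin_four (M : Matrix (Fin 4) (Fin 4) ℝ) :
    M.det =
      M 0 0 * (M 1 1 * (M 2 2 * M 3 3 - M 2 3 * M 3 2) - M 1 2 * (M 2 1 * M 3 3 - M 2 3 * M 3 1) +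
        M 1 3 * (M 2 1 * M 3 2 - M 2 2 * M 3 1)) -
      M 0 1 * (M 1 0 * (M 2 2 * M 3 3 - M 2 3 * M 3 2) - M 1 2 * (M 2 0 * M 3 3 - M 2 3 * M 3 0) +
        M 1 3 * (M 2 0 * M 3 2 - M 2 2 * M 3 0)) +
      M 0 2 * (M 1 0 * (M 2 1 * M 3 3 - M 2 3 * M 3 1) - M 1 1 * (M 2 0 * M 3 3 - M 2 3 * M 3 0) +
        M 1 3 * (M 2 0 * M 3 1 - M 2 1 * M 3 0)) -
      M 0 3 * (M 1 0 * (M 2 1 * M 3 2 - M 2 2 * M 3 1) - M 1 1 * (M 2 0 * M 3 2 - M 2 2 * M 3 0) +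
        M 1 2 * (M 2 0 * M 3 1 - M 2 1 * M 3 0)) := by
  rw [Matrix.det_succ_row_zero]
  simp [Fin.sum_univ_succ, Matrix.det_fin_three, Fin.succAbove, Matrix.submatrix_apply]
  ring

theorem det_projective_jacobian (x : Fin 4 → ℝ) (D : Fin 3 → Fin 4 → ℝ) (h : x 0 ≠ 0) :
    (Matrix.of fun i j : Fin 3 => (D j i.succ * x 0 - x i.succ * D j 0) / x 0 ^ 2).det =
      (Matrix.of ![x, D 0, D 1, D 2]).det / x 0 ^ 4 := by
  rw [Matrix.det_fin_three, det_fin_four]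
  simp
  field_simp
  ring

theorem IsWedgeFrame.sin_pos {a b c d : Fin 4 → ℝ} {α : ℝ} (F : IsWedgeFrame a b c d α) :
    0 < Real.sin α := Real.sin_pos_of_pos_of_lt_pi F.pos F.lt_pi

theorem IsWedgeFrame.abs_det {a b c d : Fin 4 → ℝ} {α : ℝ} (F : IsWedgeFrame a b c d α) :
    |(Matrix.of ![a, b, c, d]).det| = Real.sin α / 2 := by
  have hG : (Matrix.of ![a, b, c, d] : Matrix (Fin 4) (Fin 4) ℝ) * Matrix.diagonal ![-1, 1, 1, 1] *
      (Matrix.of ![a, b, c, d]).transpose =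
      !![0, -1 / 2, 0, 0; -1 / 2, 0, 0, 0; 0, 0, 1, Real.cos α; 0, 0, Real.cos α, 1] := by
    have key : (Matrix.of ![a, b, c, d] : Matrix (Fin 4) (Fin 4) ℝ) *
        Matrix.diagonal ![-1, 1, 1, 1] * (Matrix.of ![a, b, c, d]).transpose =
        Matrix.of fun i j => mink (![a, b, c, d] i) (![a, b, c, d] j) := by
      generalize ![a, b, c, d] = v
      ext i j
      rw [Matrix.mul_apply]
      simp [Matrix.mul_diagonal, Fin.sum_univ_four, mink]
      ring
    rw [key]
    ext i j
    fin_cases i <;> fin_cases j <;>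
      simp [F.aa, F.bb, F.ab, F.ac, F.ad, F.bc, F.bd, F.cc, F.dd, F.cd, mink_comm b a,
        mink_comm c a, mink_comm d a, mink_comm c b, mink_comm d b, mink_comm d c]
  have h := congrArg Matrix.det hG
  rw [Matrix.det_mul, Matrix.det_mul, Matrix.det_transpose, Matrix.det_diagonal] at h
  rw [det_fin_four !![0, -1 / 2, 0, 0; -1 / 2, 0, 0, 0; 0, 0, 1, Real.cos α;
    0, 0, Real.cos α, 1]] at h
  simp [Fin.prod_univ_four] at h
  have hs := F.sin_pos
  rw [← abs_of_pos (half_pos hs), ← sq_eq_sq_iff_abs_eq_abs]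
  linear_combination h - (1 / 4) * Real.sin_sq_add_cos_sq α

theorem IsWedgeFrame.abs_det_wedgeJacobian {a b c d : Fin 4 → ℝ} {α : ℝ}
    (F : IsWedgeFrame a b c d α) {y : Fin 3 → ℝ} (hr : 0 ≤ y 1)
    (h : wedgePoint a b c d α y 0 ≠ 0) :
    |(wedgeJacobian a b c d α y).det| = y 1 / (2 * wedgePoint a b c d α y 0 ^ 4) := by
  have hs := F.sin_pos
  have hadd : Real.sin (α - y 2) * Real.cos (y 2) + Real.sin (y 2) * Real.cos (α - y 2) =
      Real.sin α := by
    have := Real.sin_add (α - y 2) (y 2)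
    rw [sub_add_cancel] at this
    rw [this]; ring
  have hdet : (Matrix.of ![wedgePoint a b c d α y, wedgePointDeriv a c d α y 0,
      wedgePointDeriv a c d α y 1, wedgePointDeriv a c d α y 2]).det =
      -(y 1 / Real.sin α) * (Matrix.of ![a, b, c, d]).det := by
    rw [← hadd] at hs
    rw [det_fin_four, det_fin_four]
    simp [wedgePoint, wedgePointDeriv]
    rw [← hadd]
    field_simp
    ring
  rw [wedgeJacobian, det_projective_jacobian _ _ h, hdet, abs_div, abs_mul, F.abs_det, abs_neg,
    abs_of_nonneg (div_nonneg hr hs.le), abs_of_nonneg (by positivity : 0 ≤ wedgePoint a b c d α y 0 ^ 4)]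
  field_simp

namespace IsWedgeFrame

variable {a b c d : Fin 4 → ℝ} {α : ℝ}

theorem mink_self (F : IsWedgeFrame a b c d α) (P Q m n : ℝ) :
    mink (P • a + Q • b + m • c + n • d) (P • a + Q • b + m • c + n • d) =
      m ^ 2 + n ^ 2 + 2 * m * n * Real.cos α - P * Q := by
  simp only [mink_add_left, mink_add_right, mink_smul_left, mink_smul_right, F.aa, F.bb, F.ab,
    F.ac, F.ad, F.bc, F.bd, F.cc, F.dd, F.cd, mink_comm b a, mink_comm c a, mink_comm d a,
    mink_comm c b, mink_comm d b, mink_comm d c]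
  ring

theorem mink_wedgePoint_self (F : IsWedgeFrame a b c d α) (y : Fin 3 → ℝ) :
    mink (wedgePoint a b c d α y) (wedgePoint a b c d α y) = y 1 ^ 2 - y 0 := by
  have h := F.mink_self (y 0) 1 (y 1 * Real.sin (α - y 2) / Real.sin α)
    (y 1 * Real.sin (y 2) / Real.sin α)
  rw [one_smul] at h
  have hs := F.sin_pos
  rw [wedgePoint, h]
  field_simp
  linear_combination (-y 1 ^ 2) * sin_sq_eq_law_of_cosines α (y 2)

theorem mink_wedgePoint_a (F : IsWedgeFrame a b c d α) (y : Fin 3 → ℝ) :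
    mink (wedgePoint a b c d α y) a = -1 / 2 := by
  simp only [wedgePoint, mink_add_left, mink_smul_left, F.aa, mink_comm b a, F.ab, mink_comm c a,
    F.ac, mink_comm d a, F.ad]
  ring

theorem mink_wedgePoint_b (F : IsWedgeFrame a b c d α) (y : Fin 3 → ℝ) :
    mink (wedgePoint a b c d α y) b = -y 0 / 2 := by
  simp only [wedgePoint, mink_add_left, mink_smul_left, F.bb, F.ab, mink_comm c b,
    F.bc, mink_comm d b, F.bd]
  ring

theorem mink_wedgePoint_c (F : IsWedgeFrame a b c d α) (y : Fin 3 → ℝ) :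
    mink (wedgePoint a b c d α y) c = y 1 * Real.cos (y 2) := by
  simp only [wedgePoint, mink_add_left, mink_smul_left, F.ac, F.bc, F.cc, mink_comm d c, F.cd]
  have hs := F.sin_pos
  rw [Real.sin_sub]
  field_simp
  ring

theorem wedgePoint_zero_ne (F : IsWedgeFrame a b c d α) {y : Fin 3 → ℝ} (hy : y 1 ^ 2 < y 0) :
    wedgePoint a b c d α y 0 ≠ 0 := by
  intro h0
  have h := F.mink_wedgePoint_self y
  rw [mink, h0] at h
  nlinarith [sq_nonneg (wedgePoint a b c d α y 1), sq_nonneg (wedgePoint a b c d α y 2),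
    sq_nonneg (wedgePoint a b c d α y 3)]

theorem injOn_wedgeMap (F : IsWedgeFrame a b c d α) {s : Set (Fin 3 → ℝ)}
    (hs : ∀ y ∈ s, 0 < y 2 ∧ y 2 < α ∧ 0 < y 1 ∧ y 1 ^ 2 < y 0) :
    Set.InjOn (wedgeMap a b c d α) s := by
  intro y hy z hz hyz
  obtain ⟨hy0, hy1, hyr, hyw⟩ := hs y hy
  obtain ⟨hz0, hz1, hzr, hzw⟩ := hs z hz
  have hY := F.wedgePoint_zero_ne hyw
  have hZ := F.wedgePoint_zero_ne hzw
  have hX : wedgePoint a b c d α y =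
      (wedgePoint a b c d α y 0 / wedgePoint a b c d α z 0) • wedgePoint a b c d α z := by
    funext i
    refine Fin.cases ?_ (fun i => ?_) i
    · simp [hZ]
    · have := congrFun hyz i
      simp only [wedgeMap] at this
      rw [div_eq_div_iff hY hZ] at this
      rw [Pi.smul_apply, smul_eq_mul]
      field_simp
      linarith
  have ht := F.mink_wedgePoint_a y
  rw [hX, mink_smul_left, F.mink_wedgePoint_a] at ht
  rw [show wedgePoint a b c d α y 0 / wedgePoint a b c d α z 0 = 1 by linarith, one_smul] at hX
  have e0 : y 0 = z 0 := by
    have := F.mink_wedgePoint_b y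
    rw [hX, F.mink_wedgePoint_b] at this
    linarith
  have e1 : y 1 = z 1 := by
    have := F.mink_wedgePoint_self y
    rw [hX, F.mink_wedgePoint_self] at this
    rw [← sq_eq_sq₀ hyr.le hzr.le]
    linarith
  have e2 : y 2 = z 2 := by
    have := F.mink_wedgePoint_c y
    rw [hX, F.mink_wedgePoint_c, e1] at this
    have hpi := F.lt_pi
    exact Real.injOn_cos ⟨hy0.le, by linarith⟩ ⟨hz0.le, by linarith⟩
      (mul_left_cancel₀ hzr.ne' this.symm)
  funext i
  fin_cases i <;> assumption

theorem one_sub_norm_sq_wedgeMap (F : IsWedgeFrame a b c d α) {y : Fin 3 → ℝ}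
    (hy : y 1 ^ 2 < y 0) :
    1 - ‖WithLp.toLp 2 (wedgeMap a b c d α y)‖ ^ 2 =
      (y 0 - y 1 ^ 2) / wedgePoint a b c d α y 0 ^ 2 := by
  have hX := F.wedgePoint_zero_ne hy
  have h := F.mink_wedgePoint_self y
  rw [mink] at h
  simp only [EuclideanSpace.norm_sq_eq, Fin.sum_univ_three, wedgeMap, Real.norm_eq_abs, sq_abs,
    Fin.succ_zero_eq_one, Fin.succ_one_eq_two, show Fin.succ (2 : Fin 3) = 3 from rfl]
  field_simp
  linarith

theorem setLIntegral_wedgeMap_image (F : IsWedgeFrame a b c d α) {s : Set (Fin 3 → ℝ)}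
    (hm : MeasurableSet s) (hs : ∀ y ∈ s, 0 < y 2 ∧ y 2 < α ∧ 0 < y 1 ∧ y 1 ^ 2 < y 0) :
    ∫⁻ x in wedgeMap a b c d α '' s, ENNReal.ofReal (hypDensity (WithLp.toLp 2 x)) =
      ∫⁻ y in s, ENNReal.ofReal (y 1 / (2 * (y 0 - y 1 ^ 2) ^ 2)) := by
  rw [lintegral_image_eq_lintegral_abs_det_fderiv_mul volume hm
    (fun y hy => (hasFDerivAt_wedgeMap
      (F.wedgePoint_zero_ne (hs y hy).2.2.2)).hasFDerivWithinAt) (F.injOn_wedgeMap hs)]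
  refine setLIntegral_congr_fun hm fun y hy => ?_
  obtain ⟨-, -, hr, hw⟩ := hs y hy
  have hX := F.wedgePoint_zero_ne hw
  have hw' : y 0 - y 1 ^ 2 ≠ 0 := (sub_pos.2 hw).ne'
  simp only
  rw [← ENNReal.ofReal_mul (abs_nonneg _), ContinuousLinearMap.det,
    LinearMap.coe_toContinuousLinearMap, LinearMap.det_toLin',
    F.abs_det_wedgeJacobian hr.le hX, hypDensity, F.one_sub_norm_sq_wedgeMap hw]
  congr 1
  field_simp

theorem hypVolume_le (F : IsWedgeFrame a b c d α) {A B : ℝ} (hA : 0 < A) (hB : 0 < B)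
    {s N : Set E3} (hN : volume N = 0)
    (hs : ∀ x ∈ s, x ∈ N ∨ WithLp.ofLp x ∈ wedgeMap a b c d α '' wedgeRegion α A B) :
    hypVolume s ≤ ENNReal.ofReal (2 * lobachevsky (α / 2)) := by
  have hreg : ∀ y ∈ wedgeRegion α A B, 0 < y 2 ∧ y 2 < α ∧ 0 < y 1 ∧ y 1 ^ 2 < y 0 :=
    fun y hy => ⟨hy.1, hy.2.1, hy.2.2.1, wedgeRegion_sq_lt hA hB F.lt_pi hy⟩
  calc
    hypVolume s = ∫⁻ x in s, ENNReal.ofReal (hypDensity x) ∂volume.restrict hyp3 := by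
      rw [hypVolume, withDensity_apply']
    _ ≤ ∫⁻ x in s, ENNReal.ofReal (hypDensity x) :=
      lintegral_mono' (Measure.restrict_mono le_rfl Measure.restrict_le_self) le_rfl
    _ ≤ ∫⁻ x in N ∪ WithLp.ofLp ⁻¹' (wedgeMap a b c d α '' wedgeRegion α A B),
        ENNReal.ofReal (hypDensity x) := lintegral_mono_set hs
    _ ≤ _ := lintegral_union_le _ _ _
    _ = ∫⁻ x in WithLp.ofLp ⁻¹' (wedgeMap a b c d α '' wedgeRegion α A B),
        ENNReal.ofReal (hypDensity (WithLp.toLp 2 (WithLp.ofLp x))) := by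
      rw [setLIntegral_measure_zero _ _ hN, zero_add]
    _ = ∫⁻ x in wedgeMap a b c d α '' wedgeRegion α A B,
        ENNReal.ofReal (hypDensity (WithLp.toLp 2 x)) :=
      (PiLp.volume_preserving_ofLp (Fin 3)).setLIntegral_comp_preimage_emb
        (MeasurableEquiv.toLp 2 (Fin 3 → ℝ)).symm.measurableEmbedding
        (fun x => ENNReal.ofReal (hypDensity (WithLp.toLp 2 x))) _
    _ ≤ _ := by
      rw [F.setLIntegral_wedgeMap_image (measurableSet_wedgeRegion α A B) hreg]
      exact setLIntegral_wedgeRegion_le hA hB F.pos F.lt_pi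

/-- A point of the cone `P a + Q b + m c + n d` satisfying the inequalities of a tetrahedron lies in
the image of the corresponding wedge region. -/
theorem mem_wedgeMap_image (F : IsWedgeFrame a b c d α) {A B P Q m n : ℝ} (hA : 0 < A)
    (hB : 0 < B) (hm : 0 < m) (hn : 0 < n) (hQ : m / A + n / B ≤ Q) (hP : m * A + n * B ≤ P)
    {x : Fin 3 → ℝ} {X : Fin 4 → ℝ} (hX : X = P • a + Q • b + m • c + n • d)
    (hx : ∀ i, x i = X i.succ / X 0) :
    x ∈ wedgeMap a b c d α '' wedgeRegion α A B := by
  have hs := F.sin_pos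
  have hQ0 : 0 < Q := lt_of_lt_of_le (by positivity) hQ
  have hr2 : 0 < m ^ 2 + n ^ 2 + 2 * m * n * Real.cos α := by
    have : -1 < Real.cos α := by nlinarith [Real.sin_sq_add_cos_sq α]
    nlinarith [mul_pos hm hn, sq_nonneg (m - n)]
  obtain ⟨r, hr, hrr⟩ : ∃ r, 0 < r ∧ r ^ 2 = m ^ 2 + n ^ 2 + 2 * m * n * Real.cos α :=
    ⟨_, Real.sqrt_pos.2 hr2, Real.sq_sqrt hr2.le⟩
  have hsq : (n * Real.sin α) ^ 2 + (m + n * Real.cos α) ^ 2 = r ^ 2 := by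
    rw [hrr]
    linear_combination n ^ 2 * Real.sin_sq_add_cos_sq α
  have hnr : n * Real.sin α ≤ r := abs_le_of_sq_le_sq' (by nlinarith) hr.le |>.2
  have hmr := abs_le_of_sq_le_sq' (a := m + n * Real.cos α) (by nlinarith) hr.le
  set θ := Real.arccos ((m + n * Real.cos α) / r) with hθ
  have hcos : r * Real.cos θ = m + n * Real.cos α := by
    rw [hθ, Real.cos_arccos]
    · field_simp
    · rw [le_div_iff₀ hr]; linarith
    · rw [div_le_iff₀ hr]; linarith
  have hsin : r * Real.sin θ = n * Real.sin α := by
    rw [← sq_eq_sq₀ (mul_nonneg hr.le (Real.sin_nonneg_of_mem_Icc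
      ⟨Real.arccos_nonneg _, Real.arccos_le_pi _⟩)) (by positivity)]
    linear_combination r ^ 2 * Real.sin_sq_add_cos_sq θ - hsq -
      (r * Real.cos θ + (m + n * Real.cos α)) * hcos
  have hsinsub : r * Real.sin (α - θ) = m * Real.sin α := by
    rw [Real.sin_sub]
    linear_combination Real.sin α * hcos - Real.cos α * hsin
  have hθ0 : 0 < θ := by
    rcases (Real.arccos_nonneg ((m + n * Real.cos α) / r)).lt_or_eq with h | h
    · exact h
    · rw [hθ, ← h, Real.sin_zero, mul_zero] at hsin
      exact absurd hsin (by positivity)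
  have hθα : θ < α := by
    have hpos : 0 < Real.sin (α - θ) := by
      have : 0 < r * Real.sin (α - θ) := by rw [hsinsub]; positivity
      exact pos_of_mul_pos_right this hr.le
    by_contra hle
    have := Real.sin_nonneg_of_nonneg_of_le_pi (x := θ - α) (by linarith)
      (by linarith [F.pos, Real.arccos_le_pi ((m + n * Real.cos α) / r)])
    rw [← neg_sub, Real.sin_neg] at hpos
    linarith
  refine ⟨![P / Q, r / Q, θ], ⟨hθ0, hθα, div_pos hr hQ0, ?_, ?_⟩, ?_⟩
  · have : r / Q * (Real.sin (α - θ) / A + Real.sin θ / B) =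
        (r * Real.sin (α - θ) / A + r * Real.sin θ / B) / Q := by ring
    simp only [Matrix.cons_val]
    rw [this, hsinsub, hsin, div_le_iff₀ hQ0]
    calc _ = (m / A + n / B) * Real.sin α := by ring
      _ ≤ Q * Real.sin α := mul_le_mul_of_nonneg_right hQ hs.le
      _ = _ := mul_comm _ _
  · have : r / Q * ((A * Real.sin (α - θ) + B * Real.sin θ) / Real.sin α) =
        (A * (r * Real.sin (α - θ)) + B * (r * Real.sin θ)) / Real.sin α / Q := by ring
    simp only [Matrix.cons_val]
    rw [this, hsinsub, hsin]
    refine div_le_div_of_nonneg_right ?_ hQ0.le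
    rw [div_le_iff₀ hs]
    calc _ = (m * A + n * B) * Real.sin α := by ring
      _ ≤ P * Real.sin α := mul_le_mul_of_nonneg_right hP hs.le
  · have hW : wedgePoint a b c d α ![P / Q, r / Q, θ] = Q⁻¹ • X := by
      have e1 : r / Q * Real.sin (α - θ) / Real.sin α = Q⁻¹ * m := by
        rw [div_mul_eq_mul_div, hsinsub]; field_simp
      have e2 : r / Q * Real.sin θ / Real.sin α = Q⁻¹ * n := by
        rw [div_mul_eq_mul_div, hsin]; field_simp
      simp only [wedgePoint, Matrix.cons_val]
      rw [e1, e2, hX]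
      simp only [smul_add, smul_smul, inv_mul_cancel₀ hQ0.ne', one_smul]
      rw [div_eq_inv_mul]
    funext i
    rw [hx, wedgeMap, hW]
    simp only [Pi.smul_apply, smul_eq_mul]
    rw [mul_div_mul_left _ _ (inv_ne_zero hQ0.ne')]

end IsWedgeFrame

/-- The vector of `ℝ⁴` with time component `s` and space component `x`. -/
def timeSpace (s : ℝ) (x : E3) : Fin 4 → ℝ := ![s, x 0, x 1, x 2]

theorem timeSpace_succ (s : ℝ) (x : E3) (i : Fin 3) : timeSpace s x i.succ = x i := by
  fin_cases i <;> rfl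

theorem timeSpace_add (s t : ℝ) (x y : E3) :
    timeSpace s x + timeSpace t y = timeSpace (s + t) (x + y) := by
  funext i
  fin_cases i <;> rfl

theorem smul_timeSpace (r s : ℝ) (x : E3) : r • timeSpace s x = timeSpace (r * s) (r • x) := by
  funext i
  fin_cases i <;> rfl

theorem mink_timeSpace (s t : ℝ) (x y : E3) :
    mink (timeSpace s x) (timeSpace t y) = inner ℝ x y - s * t := by
  simp [mink, timeSpace, PiLp.inner_apply, Fin.sum_univ_three]
  ring

theorem hypMetric_comm (x u w : E3) : hypMetric x u w = hypMetric x w u := by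
  rw [hypMetric, hypMetric, real_inner_comm]; ring

theorem hypMetric_sub_right (x u v w : E3) :
    hypMetric x u (v - w) = hypMetric x u v - hypMetric x u w := by
  simp only [hypMetric, inner_sub_right]; ring

theorem hypMetric_smul_right (x u w : E3) (t : ℝ) :
    hypMetric x u (t • w) = t * hypMetric x u w := by
  simp only [hypMetric, inner_smul_right]; ring

theorem hypMetric_sub_left (x u v w : E3) :
    hypMetric x (u - v) w = hypMetric x u w - hypMetric x v w := by
  simp only [hypMetric_comm x _ w, hypMetric_sub_right]

theorem hypMetric_smul_left (x u w : E3) (t : ℝ) :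
    hypMetric x (t • u) w = t * hypMetric x u w := by
  simp only [hypMetric_comm x _ w, hypMetric_smul_right]

theorem hypMetric_self_pos {x u : E3} (hx : ‖x‖ < 1) (hu : u ≠ 0) : 0 < hypMetric x u u := by
  have he : 0 < 1 - ‖x‖ ^ 2 := by nlinarith [norm_nonneg x]
  have := real_inner_self_pos.2 hu
  have h2 := mul_self_nonneg (inner ℝ x u)
  rw [hypMetric]
  positivity

theorem hypMetric_sq_lt {x u w : E3} (hx : ‖x‖ < 1) (h : LinearIndependent ℝ ![u, w]) :
    hypMetric x u w ^ 2 < hypMetric x u u * hypMetric x w w := by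
  rw [LinearIndependent.pair_iff] at h
  have hu : u ≠ 0 := fun h0 => one_ne_zero (h 1 0 (by simp [h0])).1
  have hupos := hypMetric_self_pos hx hu
  have hv : hypMetric x u u • w - hypMetric x u w • u ≠ 0 := fun h0 =>
    hupos.ne' (h (-hypMetric x u w) (hypMetric x u u) (by rw [← h0, neg_smul]; abel)).2
  have := hypMetric_self_pos hx hv
  simp only [hypMetric_sub_left, hypMetric_sub_right, hypMetric_smul_left,
    hypMetric_smul_right, hypMetric_comm x w u] at this
  have h2 : 0 < hypMetric x u u * (hypMetric x u u * hypMetric x w w - hypMetric x u w ^ 2) := by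
    linarith
  linarith [pos_of_mul_pos_right h2 hupos.le]

theorem hypMetric_orthComponent {x u : E3} (hx : ‖x‖ < 1) (hu : u ≠ 0) (w : E3) :
    hypMetric x u (hypOrthComponent x u w) = 0 := by
  rw [hypOrthComponent, hypMetric_sub_right, hypMetric_smul_right,
    div_mul_cancel₀ _ (hypMetric_self_pos hx hu).ne', sub_self]

theorem cos_hypAngle {x u w : E3} (hx : ‖x‖ < 1) (h : LinearIndependent ℝ ![u, w]) :
    Real.cos (hypAngle x u w) =
        hypMetric x u w / (√(hypMetric x u u) * √(hypMetric x w w)) ∧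
      0 < hypAngle x u w ∧ hypAngle x u w < Real.pi := by
  have h1 := hypMetric_sq_lt hx h
  have hu := hypMetric_self_pos hx (h.ne_zero 0)
  have hw := hypMetric_self_pos hx (h.ne_zero 1)
  simp only [Matrix.cons_val_zero, Matrix.cons_val_one] at hu hw
  have hs : 0 < √(hypMetric x u u) * √(hypMetric x w w) := by positivity
  have hlt : |hypMetric x u w / (√(hypMetric x u u) * √(hypMetric x w w))| < 1 := by
    rw [abs_div, abs_of_pos hs, div_lt_one hs]
    refine abs_lt_of_sq_lt_sq ?_ hs.le
    rwa [mul_pow, Real.sq_sqrt hu.le, Real.sq_sqrt hw.le]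
  rw [abs_lt] at hlt
  refine ⟨Real.cos_arccos hlt.1.le hlt.2.le, Real.arccos_pos.2 hlt.2, ?_⟩
  refine lt_of_le_of_ne (Real.arccos_le_pi _) fun h => ?_
  rw [hypAngle, Real.arccos_eq_pi] at h
  linarith

/-- The tangent vector `v` at the point `p` of the projective model, as a vector of the hyperboloid
model. -/
noncomputable def tangentLift (p v : E3) : Fin 4 → ℝ :=
  timeSpace 0 v + (inner ℝ p v / (1 - ‖p‖ ^ 2)) • timeSpace 1 p

theorem mink_tangentLift {p : E3} (hp : ‖p‖ < 1) (v w : E3) :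
    mink (tangentLift p v) (tangentLift p w) = (1 - ‖p‖ ^ 2) * hypMetric p v w := by
  have he : 1 - ‖p‖ ^ 2 ≠ 0 := by nlinarith [norm_nonneg p]
  simp only [tangentLift, mink_add_left, mink_add_right, mink_smul_left, mink_smul_right,
    mink_timeSpace, hypMetric, real_inner_self_eq_norm_sq, real_inner_comm p]
  field_simp
  ring

theorem mink_timeSpace_tangentLift {p : E3} (hp : ‖p‖ < 1) (v : E3) :
    mink (timeSpace 1 p) (tangentLift p v) = 0 := by
  have he : 1 - ‖p‖ ^ 2 ≠ 0 := by nlinarith [norm_nonneg p]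
  simp only [tangentLift, mink_add_right, mink_smul_right,
    mink_timeSpace, real_inner_self_eq_norm_sq]
  field_simp
  ring

theorem exists_isWedgeFrame {p u w₁ w₂ : E3} (hp : ‖p‖ < 1) (hu : u ≠ 0)
    (h1 : hypMetric p u w₁ = 0) (h2 : hypMetric p u w₂ = 0)
    (hw : LinearIndependent ℝ ![w₁, w₂]) :
    ∃ a b c d : Fin 4 → ℝ, IsWedgeFrame a b c d (hypAngle p w₁ w₂) ∧
      (∃ s : ℝ, 0 < s ∧ timeSpace 1 p = s • (a + b)) ∧ (∃ s : ℝ, tangentLift p u = s • (a - b)) ∧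
      (∃ s : ℝ, 0 < s ∧ tangentLift p w₁ = s • c) ∧ (∃ s : ℝ, 0 < s ∧ tangentLift p w₂ = s • d) := by
  obtain ⟨hcos, hpos, hlt⟩ := cos_hypAngle hp hw
  have he : 0 < 1 - ‖p‖ ^ 2 := by nlinarith [norm_nonneg p]
  have gu := hypMetric_self_pos hp hu
  have g1 : 0 < hypMetric p w₁ w₁ := hypMetric_self_pos hp (hw.ne_zero 0)
  have g2 : 0 < hypMetric p w₂ w₂ := hypMetric_self_pos hp (hw.ne_zero 1)
  have mPP : mink (timeSpace 1 p) (timeSpace 1 p) = -(1 - ‖p‖ ^ 2) := by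
    rw [mink_timeSpace, real_inner_self_eq_norm_sq]; ring
  have mPt := mink_timeSpace_tangentLift hp
  have mtt := mink_tangentLift hp
  generalize 1 - ‖p‖ ^ 2 = e at *
  generalize timeSpace 1 p = P at *
  obtain ⟨E, hE, rfl⟩ : ∃ E, 0 < E ∧ E ^ 2 = e := ⟨√e, Real.sqrt_pos.2 he, Real.sq_sqrt he.le⟩
  have su := Real.sq_sqrt gu.le
  have s1 := Real.sq_sqrt g1.le
  have s2 := Real.sq_sqrt g2.le
  have pu := Real.sqrt_pos.2 gu
  have p1 := Real.sqrt_pos.2 g1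
  have p2 := Real.sqrt_pos.2 g2
  generalize √(hypMetric p u u) = U at *
  generalize √(hypMetric p w₁ w₁) = G at *
  generalize √(hypMetric p w₂ w₂) = H at *
  refine ⟨(2 * E)⁻¹ • P + (2 * E * U)⁻¹ • tangentLift p u,
    (2 * E)⁻¹ • P + (-(2 * E * U)⁻¹) • tangentLift p u,
    (E * G)⁻¹ • tangentLift p w₁, (E * H)⁻¹ • tangentLift p w₂,
    ⟨?_, ?_, ?_, ?_, ?_, ?_, ?_, ?_, ?_, ?_, hpos, hlt⟩,
    ⟨E, hE, ?_⟩, ⟨E * U, ?_⟩, ⟨E * G, by positivity, ?_⟩, ⟨E * H, by positivity, ?_⟩⟩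
  iterate 10
    · simp only [mink_add_left, mink_add_right, mink_smul_left, mink_smul_right, mPP, mPt, mtt,
        mink_comm _ P, ← su, ← s1, ← s2, h1, h2, hcos]
      field_simp
      try ring
  · funext i
    simp only [Pi.smul_apply, Pi.add_apply, smul_eq_mul]
    field_simp
    ring
  · funext i
    simp only [Pi.smul_apply, Pi.add_apply, Pi.sub_apply, smul_eq_mul]
    field_simp
    ring
  · rw [smul_smul, mul_inv_cancel₀ (by positivity), one_smul]
  · rw [smul_smul, mul_inv_cancel₀ (by positivity), one_smul]

theorem timeSpace_one_eq_tangentLift (p u w : E3) (τ : ℝ) :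
    timeSpace 1 (p + τ • u + w) =
      (1 - τ * (inner ℝ p u / (1 - ‖p‖ ^ 2)) - inner ℝ p w / (1 - ‖p‖ ^ 2)) • timeSpace 1 p +
        τ • tangentLift p u + tangentLift p w := by
  funext i
  simp only [tangentLift, Pi.add_apply, Pi.smul_apply, smul_eq_mul]
  refine Fin.cases ?_ (fun i => ?_) i
  · simp [timeSpace]
    ring
  · simp only [timeSpace_succ, PiLp.add_apply, PiLp.smul_apply, smul_eq_mul]
    ring

/-- The coordinates of a point of the closed ball in the half plane spanned by a geodesic and a
normal direction. -/
theorem IsWedgeFrame.exists_coords {a b c d : Fin 4 → ℝ} {α : ℝ} (F : IsWedgeFrame a b c d α)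
    {p u w v : E3} {s s' μ τ : ℝ} {e : Fin 4 → ℝ} (hp : ‖p‖ < 1) (hv : ‖v‖ ≤ 1)
    (hs : 0 < s) (hP : timeSpace 1 p = s • (a + b)) (hU : tangentLift p u = s' • (a - b))
    (hW : tangentLift p w = μ • e) (hvw : v = p + τ • u + w) (he : e = c ∨ e = d) :
    ∃ P Q : ℝ, 0 ≤ P ∧ 0 ≤ Q ∧ μ ^ 2 ≤ P * Q ∧ timeSpace 1 v = P • a + Q • b + μ • e := by
  have h := timeSpace_one_eq_tangentLift p u w τ
  rw [← hvw, hP, hU, hW] at h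
  set x := 1 - τ * (inner ℝ p u / (1 - ‖p‖ ^ 2)) - inner ℝ p w / (1 - ‖p‖ ^ 2)
  have hV : timeSpace 1 v = (x * s + τ * s') • a + (x * s - τ * s') • b + μ • e := by
    rw [h]; module
  generalize x * s + τ * s' = P at hV
  generalize x * s - τ * s' = Q at hV
  have hself : mink (timeSpace 1 v) (timeSpace 1 v) = μ ^ 2 - P * Q := by
    rcases he with rfl | rfl
    · have := F.mink_self P Q μ 0
      rw [zero_smul, add_zero, ← hV] at this
      rw [this]; ring
    · have := F.mink_self P Q 0 μ
      rw [zero_smul, add_zero, ← hV] at this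
      rw [this]; ring
  have hle : μ ^ 2 ≤ P * Q := by
    rw [mink_timeSpace, real_inner_self_eq_norm_sq] at hself
    nlinarith [norm_nonneg v]
  have hsum : 0 < P + Q := by
    have h1 : mink (timeSpace 1 v) (timeSpace 1 p) = -(s * (P + Q) / 2) := by
      have hea : mink e a = 0 := by
        rcases he with rfl | rfl
        · rw [mink_comm, F.ac]
        · rw [mink_comm, F.ad]
      have heb : mink e b = 0 := by
        rcases he with rfl | rfl
        · rw [mink_comm, F.bc]
        · rw [mink_comm, F.bd]
      rw [hV, hP]
      simp only [mink_add_left, mink_add_right, mink_smul_left, mink_smul_right, F.aa, F.bb, F.ab,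
        mink_comm b a, hea, heb]
      ring
    rw [mink_timeSpace] at h1
    have h2 : inner ℝ v p < 1 := by
      refine (real_inner_le_norm v p).trans_lt ?_
      nlinarith [norm_nonneg v, norm_nonneg p]
    have h3 : 0 < s * (P + Q) := by linarith
    exact pos_of_mul_pos_right h3 hs.le
  have hPQ : 0 ≤ P * Q := (sq_nonneg μ).trans hle
  exact ⟨P, Q, by nlinarith, by nlinarith, hle, hV⟩

theorem norm_lt_one_of_mem_openSegment {x y p : E3} (hx : ‖x‖ ≤ 1) (hy : ‖y‖ ≤ 1) (hxy : x ≠ y)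
    (hp : p ∈ openSegment ℝ x y) : ‖p‖ < 1 := by
  obtain ⟨s, t, hs, ht, hst, rfl⟩ := hp
  exact norm_combo_lt_of_ne hx hy hxy hs ht hst

theorem sum_univ_eq_of_nodup {M : Type*} [AddCommMonoid M] {i j k l : Fin 4}
    (h : [i, j, k, l].Nodup) (f : Fin 4 → M) : ∑ n, f n = f i + f j + f k + f l := by
  have hu : (Finset.univ : Finset (Fin 4)) = [i, j, k, l].toFinset := by
    refine (Finset.eq_univ_of_card _ ?_).symm
    rw [List.toFinset_card_of_nodup h]
    rfl
  rw [hu, List.sum_toFinset _ h]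
  simp [add_assoc]

namespace HypTetrahedron

/-- The vertices of a tetrahedron, as an affine basis. -/
noncomputable def affineBasis (T : HypTetrahedron) : AffineBasis (Fin 4) ℝ E3 :=
  ⟨T.vertex, T.independent,
    T.independent.affineSpan_eq_top_iff_card_eq_finrank_add_one.2 (by simp)⟩

theorem exists_weights_of_mem_carrier (T : HypTetrahedron) {x : E3} (hx : x ∈ T.carrier) :
    x ∈ frontier (convexHull ℝ (Set.range T.vertex)) ∨
      ∃ f : Fin 4 → ℝ, (∀ n, 0 < f n) ∧ ∑ n, f n = 1 ∧ ∑ n, f n • T.vertex n = x := by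
  by_cases h : x ∈ interior (convexHull ℝ (Set.range T.vertex))
  · right
    have h' := T.affineBasis.interior_convexHull
    change interior (convexHull ℝ (Set.range T.vertex)) = _ at h'
    rw [h'] at h
    exact ⟨fun n => T.affineBasis.coord n x, h, T.affineBasis.sum_coord_apply_eq_one x,
      T.affineBasis.linear_combination_coord_eq_self x⟩
  · exact Or.inl ⟨subset_closure hx.1, h⟩

theorem timeSpace_sum_smul {ι : Type*} (s : Finset ι) (f : ι → ℝ) (v : ι → E3) :
    ∑ n ∈ s, f n • timeSpace 1 (v n) = timeSpace (∑ n ∈ s, f n) (∑ n ∈ s, f n • v n) := by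
  classical
  induction s using Finset.induction_on with
  | empty => funext i; fin_cases i <;> rfl
  | insert n s hn ih =>
    rw [Finset.sum_insert hn, Finset.sum_insert hn, Finset.sum_insert hn, ih, smul_timeSpace,
      timeSpace_add, mul_one]

theorem linearIndependent_orthComponent (T : HypTetrahedron) {i j k l : Fin 4}
    (h : [i, j, k, l].Nodup) {p : E3} (hp : p ∈ openSegment ℝ (T.vertex i) (T.vertex j)) :
    LinearIndependent ℝ
      ![hypOrthComponent p (T.vertex j - T.vertex i) (T.vertex k - p),
        hypOrthComponent p (T.vertex j - T.vertex i) (T.vertex l - p)] := by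
  simp only [List.nodup_cons, List.mem_cons, List.not_mem_nil, or_false, not_or] at h
  obtain ⟨⟨hij, hik, hil⟩, ⟨hjk, hjl⟩, hkl, -⟩ := h
  have key : ∀ m n : Fin 4, i ≠ m → j ≠ m →
      (T.affineBasis.coord m).linear
        (hypOrthComponent p (T.vertex j - T.vertex i) (T.vertex n - p)) =
      T.affineBasis.coord m (T.vertex n) := by
    intro m n him hjm
    have e : ∀ n, T.affineBasis.coord m (T.vertex n) = if m = n then 1 else 0 :=
      fun n => T.affineBasis.coord_apply m n
    have hu : (T.affineBasis.coord m).linear (T.vertex j - T.vertex i) = 0 := by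
      rw [← vsub_eq_sub, AffineMap.linearMap_vsub, e, e, if_neg (Ne.symm hjm),
        if_neg (Ne.symm him)]
      simp
    have hp0 : T.affineBasis.coord m p = 0 := by
      rw [openSegment_eq_image_lineMap] at hp
      obtain ⟨t, -, rfl⟩ := hp
      rw [AffineMap.apply_lineMap, e, e, if_neg (Ne.symm hjm), if_neg (Ne.symm him)]
      simp
    rw [hypOrthComponent, map_sub, map_smul, hu, smul_zero, sub_zero, ← vsub_eq_sub,
      AffineMap.linearMap_vsub, hp0]
    simp
  rw [LinearIndependent.pair_iff]
  intro x y hxy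
  have hk := congrArg (T.affineBasis.coord k).linear hxy
  have hl := congrArg (T.affineBasis.coord l).linear hxy
  have e : ∀ m n, T.affineBasis.coord m (T.vertex n) = if m = n then 1 else 0 :=
    fun m n => T.affineBasis.coord_apply m n
  rw [map_add, map_smul, map_smul, key _ _ hik hjk, key _ _ hik hjk, e, e] at hk
  rw [map_add, map_smul, map_smul, key _ _ hil hjl, key _ _ hil hjl, e, e] at hl
  simp [hkl] at hk
  simp [Ne.symm hkl] at hl
  exact ⟨hk, hl⟩

end HypTetrahedron

theorem mainTheorem4 (T : HypTetrahedron) (i j k l : Fin 4) (hijkl : [i, j, k, l].Nodup)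
    (p : E3) (hp : p ∈ openSegment ℝ (T.vertex i) (T.vertex j))
    (α : ℝ) (hα : α = T.dihedralAngle i j k l p) :
    hypVolume T.carrier < ⊤ ∧
      (hypVolume T.carrier).toReal ≤ 2 * lobachevsky (α / 2) := by
  have hij : i ≠ j := fun h => by simp [h] at hijkl
  have hV : T.vertex i ≠ T.vertex j := fun h => hij (T.independent.injective h)
  have hp1 := norm_lt_one_of_mem_openSegment (T.norm_le_one i) (T.norm_le_one j) hV hp
  have hu : T.vertex j - T.vertex i ≠ 0 := sub_ne_zero.2 hV.symm
  obtain ⟨a, b, c, d, F, ⟨s, hs, hP⟩, ⟨s', hU⟩, ⟨μ, hμ, hW₁⟩, ⟨ν, hν, hW₂⟩⟩ :=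
    exists_isWedgeFrame hp1 hu (hypMetric_orthComponent hp1 hu (T.vertex k - p))
      (hypMetric_orthComponent hp1 hu (T.vertex l - p))
      (T.linearIndependent_orthComponent hijkl hp)
  rw [show hypAngle p _ _ = α from hα.symm] at F
  have hzero : tangentLift p 0 = (0 : ℝ) • c := by
    funext n
    refine Fin.cases ?_ (fun n => ?_) n
    · simp [tangentLift, timeSpace]
    · simp [tangentLift, timeSpace_succ]
  obtain ⟨t₀, t₁, ht₀, ht₁, ht, hpt⟩ := hp
  obtain ⟨Pi, Qi, hPi, hQi, -, hXi⟩ := F.exists_coords (v := T.vertex i) (τ := -t₁) hp1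
    (T.norm_le_one i) hs hP hU hzero (by
      rw [← hpt, show t₀ = 1 - t₁ by linarith]; module) (Or.inl rfl)
  obtain ⟨Pj, Qj, hPj, hQj, -, hXj⟩ := F.exists_coords (v := T.vertex j) (τ := t₀) hp1
    (T.norm_le_one j) hs hP hU hzero (by
      rw [← hpt, show t₁ = 1 - t₀ by linarith]; module) (Or.inl rfl)
  obtain ⟨Pk, Qk, hPk, hQk, hPQk, hXk⟩ := F.exists_coords (v := T.vertex k) hp1
    (τ := hypMetric p (T.vertex j - T.vertex i) (T.vertex k - p) /
      hypMetric p (T.vertex j - T.vertex i) (T.vertex j - T.vertex i))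
    (T.norm_le_one k) hs hP hU hW₁ (by rw [hypOrthComponent]; module) (Or.inl rfl)
  obtain ⟨Pl, Ql, hPl, hQl, hPQl, hXl⟩ := F.exists_coords (v := T.vertex l) hp1
    (τ := hypMetric p (T.vertex j - T.vertex i) (T.vertex l - p) /
      hypMetric p (T.vertex j - T.vertex i) (T.vertex j - T.vertex i))
    (T.norm_le_one l) hs hP hU hW₂ (by rw [hypOrthComponent]; module) (Or.inr rfl)
  have hQk' : 0 < Qk := by
    rcases hQk.lt_or_eq with h | rfl
    · exact h
    · nlinarith
  have hQl' : 0 < Ql := by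
    rcases hQl.lt_or_eq with h | rfl
    · exact h
    · nlinarith
  have hbound : hypVolume T.carrier ≤ ENNReal.ofReal (2 * lobachevsky (α / 2)) := by
    refine F.hypVolume_le (div_pos hμ hQk') (div_pos hν hQl')
      ((convex_convexHull ℝ (Set.range T.vertex)).addHaar_frontier volume) fun x hx => ?_
    refine (T.exists_weights_of_mem_carrier hx).imp_right ?_
    rintro ⟨f, hf, hf1, hfx⟩
    have hX := HypTetrahedron.timeSpace_sum_smul Finset.univ f T.vertex
    rw [hf1, hfx, sum_univ_eq_of_nodup hijkl, hXi, hXj, hXk, hXl] at hX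
    refine F.mem_wedgeMap_image (P := f i * Pi + f j * Pj + f k * Pk + f l * Pl)
      (Q := f i * Qi + f j * Qj + f k * Qk + f l * Ql) (m := f k * μ) (n := f l * ν)
      (X := timeSpace 1 x) (div_pos hμ hQk') (div_pos hν hQl') (mul_pos (hf k) hμ)
      (mul_pos (hf l) hν) ?_ ?_ ?_ ?_
    · have e1 : f k * μ / (μ / Qk) = f k * Qk := by field_simp
      have e2 : f l * ν / (ν / Ql) = f l * Ql := by field_simp
      rw [e1, e2]
      linarith [mul_nonneg (hf i).le hQi, mul_nonneg (hf j).le hQj]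
    · have e1 : f k * μ * (μ / Qk) ≤ f k * Pk := by
        rw [mul_assoc]
        refine mul_le_mul_of_nonneg_left ?_ (hf k).le
        rw [← mul_div_assoc, div_le_iff₀ hQk']
        linarith
      have e2 : f l * ν * (ν / Ql) ≤ f l * Pl := by
        rw [mul_assoc]
        refine mul_le_mul_of_nonneg_left ?_ (hf l).le
        rw [← mul_div_assoc, div_le_iff₀ hQl']
        linarith
      linarith [mul_nonneg (hf i).le hPi, mul_nonneg (hf j).le hPj]
    · rw [← hX]; module
    · intro n
      rw [timeSpace_succ]
      simp [timeSpace]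
  have hΛ := two_mul_lobachevsky_half_nonneg F.pos F.lt_pi
  exact ⟨hbound.trans_lt ENNReal.ofReal_lt_top,
    (ENNReal.toReal_mono ENNReal.ofReal_ne_top hbound).trans_eq (ENNReal.toReal_ofReal hΛ)⟩
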